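/- Let $\nu$ denote a Lévy measure on $\mathbb R$, i.e. a Borel measure with $\nu(\{0\})=0$ and $\int (x^2\wedge 1)\,\nu(dx)<\infty$. For $\varepsilon>0$ put $\nu_\varepsilon=\nu\mathbf 1_{[-\varepsilon,\varepsilon]}$, $\sigma^2(\varepsilon)=\int x^2\,\nu_\varepsilon(dx)$, $\lambda_{0,\varepsilon}=\lim_{\eta\to0}\nu(\{\eta<|x|<\varepsilon\})\in[0,\infty]$, and for $b\in\mathbb R$ let $b(\varepsilon)=b+\int_{1<|x|\le \varepsilon}x\,\nu(dx)$ (the integral being $0$ if $\varepsilon\le 1$). For $\Sigma\ge0$ let $X(\varepsilon)=(X_t(\varepsilon))_{t\ge0}$ be a Lévy process with Lévy triplet $(b,\Sigma^2,\nu_\varepsilon)$, i.e. $$\mathbb E\big[e^{iuX_t(\varepsilon)}\big]=\exp\Big(t\Big(ibu-\frac{\Sigma^2u^2}{2}+\int\big(e^{iux}-1-iux\mathbf 1_{|x|\le1}\big)\nu_\varepsilon(dx)\Big)\Big).$$ For $\Delta>0$ let $\tilde X_\Delta(\varepsilon)=(X_\Delta(\varepsilon)-\Delta b(\varepsilon))/\sqrt{\Delta(\Sigma^2+\sigma^2(\varepsilon))}$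 and $$\Psi_\varepsilon(t)=\mathbb E\big[e^{it\tilde X_\Delta(\varepsilon)}\big]-e^{-\Delta\lambda_{0,\varepsilon}}\mathbf 1_{\{\Sigma=0\}},\qquad e^{-\infty}:=0 .$$ Let $\beta\in(0,2)$, $c_+>c_->0$ and $c_{\max}\ge0$. There is $c_0>0$ depending only on $\beta,c_+,c_-,c_{\max}$ such that for every $c\ge c_0$ there is $\tilde c\in(0,1)$ depending only on $\beta,c_+,c_-,c_{\max},c$ with the following property. Let $b\in\mathbb R$, $\Sigma\ge0$, $\Delta>0$, $\varepsilon>0$, let $n\ge1$ be an integer, and let $\nu$ be a Lévy measure that is absolutely continuous with respect to the Lebesgue measure and satisfies $$\frac{c_-}{|x|^{\beta+1}}\le\frac{d\nu(x)}{dx}\le\frac{c_+}{|x|^{\beta+1}}\qquad\text{for almost every }x\in[-\varepsilon,\varepsilon]\setminus\{0\}.$$ Assume that $n^{c_{\max}}\Delta\ge1$, that $\log(\Sigma^2+\sigma^2(\varepsilon))/\log(e\vee n)\le c_{\max}$, and that $$\varepsilon\le\tilde c\,\sqrt{\Delta(\Sigma^2+\sigma^2(\varepsilon))}\,/\sqrt{\log(e\vee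 n)}.$$ Then $\Psi_\varepsilon$ is infinitely differentiable and, for every integer $k$ with $0\le k\le401\log(e\vee n)$, the function $|\Psi_\varepsilon^{(k)}|^2$ is integrable on $[c\log(e\vee n),\infty)$ and $$\int_{c\log(e\vee n)}^{\infty}\big|\Psi_\varepsilon^{(k)}(t)\big|^2\,dt\le 3\,k!\,n^{-4}.$$ -/

import Mathlib

open MeasureTheory ProbabilityTheory Set Filter
open scoped NNReal ENNReal Topology

namespace SmallJumps

/-- A Lévy measure on `ℝ`: a Borel measure with `ν({0}) = 0` and `∫ (x² ∧ 1) ν(dx) < ∞`. -/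
structure IsLevyMeasure (ν : Measure ℝ) : Prop where
  zero : ν {0} = 0
  lintegral_lt_top : ∫⁻ x, ENNReal.ofReal (min (x ^ 2) 1) ∂ν < ∞

/-- A real-valued Lévy process `X = (X_t)_{t ≥ 0}` on `(Ω, P)`: it starts at `0`, has independent
and stationary increments, and its paths are right-continuous with left limits. -/
structure IsLevyProcess {Ω : Type*} [MeasurableSpace Ω] (X : ℝ≥0 → Ω → ℝ) (P : Measure Ω) :
    Prop where
  measurable : ∀ t, Measurable (X t)
  zero : ∀ᵐ ω ∂P, X 0 ω = 0
  indep : HasIndepIncrements X P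
  stationary : ∀ s t, IdentDistrib (fun ω => X (s + t) ω - X s ω) (X t) P P
  cadlag : ∀ᵐ ω ∂P, ∀ t, ContinuousWithinAt (fun s => X s ω) (Ici t) t ∧
    ∃ l, Tendsto (fun s => X s ω) (𝓝[<] t) (𝓝 l)

/-- The Lévy–Khintchine exponent of the triplet `(b, sig², ν)`, with the truncation function
`x ↦ x 1_{|x| ≤ 1}`:
`i b u - sig² u² / 2 + ∫ (e^{iux} - 1 - i u x 1_{|x| ≤ 1}) ν(dx)`. -/
noncomputable def levyExponent (b sig : ℝ) (ν : Measure ℝ) (u : ℝ) : ℂ :=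
  Complex.I * b * u - (sig : ℂ) ^ 2 * (u : ℂ) ^ 2 / 2 +
    ∫ x : ℝ, (Complex.exp (Complex.I * u * x) - 1 -
      (if |x| ≤ 1 then Complex.I * u * x else 0)) ∂ν

/-- `X ∼ (b, sig², ν)`: `X` is a Lévy process with Lévy triplet `(b, sig², ν)`, that is,
`E[e^{iuX_t}] = exp(t · levyExponent b sig ν u)`. -/
structure HasLevyTriplet {Ω : Type*} [MeasurableSpace Ω] (X : ℝ≥0 → Ω → ℝ) (P : Measure Ω)
    (b sig : ℝ) (ν : Measure ℝ) : Prop extends IsLevyProcess X P where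
  charFun_eq : ∀ (t : ℝ≥0) (u : ℝ),
    charFun (P.map (X t)) u = Complex.exp ((t : ℝ) * levyExponent b sig ν u)

/-- `ν_ε = ν 1_{[-ε, ε]}`. -/
noncomputable def smallJumpMeasure (ν : Measure ℝ) (ε : ℝ) : Measure ℝ :=
  ν.restrict (Icc (-ε) ε)

/-- `σ²(ε) = ∫_{|x| ≤ ε} x² ν(dx)`. -/
noncomputable def sigmaSq (ν : Measure ℝ) (ε : ℝ) : ℝ :=
  ∫ x, x ^ 2 ∂(smallJumpMeasure ν ε)

/-- The drift `b(ε)` associated with `(b, ν)`: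
`b - ∫_{ε < |x| ≤ 1} x ν(dx)` if `ε ≤ 1` and `b + ∫_{1 < |x| ≤ ε} x ν(dx)` if `ε > 1`. -/
noncomputable def drift (b : ℝ) (ν : Measure ℝ) (ε : ℝ) : ℝ :=
  b + if ε ≤ 1 then -∫ x in {x : ℝ | ε < |x| ∧ |x| ≤ 1}, x ∂ν
      else ∫ x in {x : ℝ | 1 < |x| ∧ |x| ≤ ε}, x ∂ν

/-- `λ_{η,ε} = ν({x : η < |x| < ε})`. -/
noncomputable def jumpIntensity (ν : Measure ℝ) (η ε : ℝ) : ℝ≥0∞ :=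
  ν {x : ℝ | η < |x| ∧ |x| < ε}

/-- `λ_{0,ε} = lim_{η → 0} λ_{η,ε} ∈ [0, ∞]`; since `λ_{η,ε}` increases as `η` decreases to `0`,
the limit is the supremum over `η > 0`. -/
noncomputable def totalJumpIntensity (ν : Measure ℝ) (ε : ℝ) : ℝ≥0∞ :=
  ⨆ (η : ℝ) (_ : 0 < η), jumpIntensity ν η ε

/-- `e^{-Δ λ_{0,ε}}`, with the convention `e^{-∞} = 0`. -/
noncomputable def noJumpProb (ν : Measure ℝ) (ε Δ : ℝ) : ℝ :=
  if totalJumpIntensity ν ε = ∞ then 0 else Real.exp (-(Δ * (totalJumpIntensity ν ε).toReal))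

/-- The rescaled increment `(X_Δ - Δ b(ε)) / √(Δ (sig² + σ²(ε)))` of a process
`X ∼ (b, sig², ν)`, where `ν` is carried by `[-ε, ε]`. -/
noncomputable def rescaledIncrement {Ω : Type*} (X : ℝ≥0 → Ω → ℝ) (b sig : ℝ) (ν : Measure ℝ)
    (ε : ℝ) (Δ : ℝ≥0) (ω : Ω) : ℝ :=
  (X Δ ω - Δ * drift b ν ε) / Real.sqrt (Δ * (sig ^ 2 + sigmaSq ν ε))

/-- `Ψ_ε(t) = E[e^{itX̃_Δ(ε)}] - e^{-Δ λ_{0,ε}} 1_{sig = 0}` where `X̃_Δ(ε)` is the rescaled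
increment. -/
noncomputable def Psi {Ω : Type*} [MeasurableSpace Ω] (P : Measure Ω) (X : ℝ≥0 → Ω → ℝ)
    (b sig : ℝ) (ν : Measure ℝ) (ε : ℝ) (Δ : ℝ≥0) (t : ℝ) : ℂ :=
  (∫ ω, Complex.exp (Complex.I * t * rescaledIncrement X b sig ν ε Δ ω) ∂P) -
    (if sig = 0 then (noJumpProb ν ε Δ : ℂ) else 0)

/-- `log(e ∨ n)`. -/
noncomputable def logMax (n : ℕ) : ℝ :=
  Real.log (max (Real.exp 1) n)

end SmallJumps

/-! The density lower bound makes the jump activity infinite, so the subtracted atom vanishes and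
`Psi` is the characteristic function itself, `exp` of an entire exponent
(`integral_exp_rescaledIncrement`, `noJumpProb_eq_zero`). All derivatives are then controlled at
once by Cauchy's estimate on a circle of radius R = √(401 L) around t, with L = `logMax n`: since k
≤ R², one has k! ≤ R^(2k), which leaves |Psi^(k)(t)|² ≤ k! B², B being the maximum on the circle
(`sq_norm_iteratedDeriv_le`).

To bound B, write z = u + iw and M = ε/s, where s is the normalising scale. The imaginary part costs
at most w² ≤ 401 L, because M ≤ 1/(c√L) keeps the tilt e^(-wx/s) bounded below by e⁻¹ on the jumps.
The real part gains κ u² max(1, uM)^(β-2), with κ proportional to `cminus / cplus`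
(`re_scaledExponent_le`). Half of the gain is spent as a multiple of c²L, which beats the cost and
yields n⁻⁴ for large c; the other half, of order t^β, makes the tail integrable
(`average_le_sq_mul_max_rpow`). -/

namespace SmallJumps

/-! ### Compensated exponents at complex arguments. -/

/-- The exponent `∫ (e^{izx} - 1 - izx) μ(dx)` of a compensated jump measure at complex `z`. -/
noncomputable def compensatedExponent (μ : Measure ℝ) (z : ℂ) : ℂ :=
  ∫ x : ℝ, (Complex.exp (Complex.I * z * x) - 1 - Complex.I * z * x) ∂μ

theorem norm_exp_sub_one_le (w : ℂ) : ‖Complex.exp w - 1‖ ≤ ‖w‖ * Real.exp ‖w‖ := by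
  simpa using Complex.norm_exp_sub_sum_le_norm_mul_exp w 1

theorem norm_exp_sub_one_sub_le (w : ℂ) :
    ‖Complex.exp w - 1 - w‖ ≤ ‖w‖ ^ 2 * Real.exp ‖w‖ := by
  simpa [Finset.sum_range_succ, sub_sub] using Complex.norm_exp_sub_sum_le_norm_mul_exp w 2

variable {μ : Measure ℝ} {ε : ℝ}

theorem integrable_compensated (hμ : ∀ᵐ x ∂μ, |x| ≤ ε) (hint : Integrable (fun x => x ^ 2) μ)
    (z : ℂ) :
    Integrable (fun x : ℝ => Complex.exp (Complex.I * z * x) - 1 - Complex.I * z * x) μ := by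
  refine (hint.const_mul (‖z‖ ^ 2 * Real.exp (‖z‖ * ε))).mono'
    (by fun_prop) ?_
  filter_upwards [hμ] with x hx
  refine (norm_exp_sub_one_sub_le _).trans ?_
  have h : ‖Complex.I * z * x‖ = ‖z‖ * |x| := by simp
  rw [h, mul_pow, sq_abs]
  have : Real.exp (‖z‖ * |x|) ≤ Real.exp (‖z‖ * ε) := by gcongr
  nlinarith [mul_le_mul_of_nonneg_left this (by positivity : 0 ≤ ‖z‖ ^ 2 * x ^ 2)]

theorem differentiable_compensatedExponent (hμ : ∀ᵐ x ∂μ, |x| ≤ ε)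
    (hint : Integrable (fun x => x ^ 2) μ) : Differentiable ℂ (compensatedExponent μ) := by
  intro z₀
  refine (hasDerivAt_integral_of_dominated_loc_of_deriv_le (s := Metric.ball z₀ 1)
    (F' := fun z x => Complex.exp (Complex.I * z * x) * (Complex.I * x) - Complex.I * x)
    (bound := fun x => (‖z₀‖ + 1) * Real.exp ((‖z₀‖ + 1) * ε) * x ^ 2)
    (Metric.ball_mem_nhds z₀ one_pos) (Eventually.of_forall fun z => by fun_prop)
    (integrable_compensated hμ hint z₀) (by fun_prop) ?_ (hint.const_mul _)
    ?_).2.differentiableAt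
  · filter_upwards [hμ] with x hx z hz
    have hz' : ‖z‖ ≤ ‖z₀‖ + 1 := by
      have := norm_sub_norm_le z z₀
      rw [Metric.mem_ball, dist_eq_norm] at hz
      linarith
    rw [← sub_one_mul, norm_mul]
    have h1 := norm_exp_sub_one_le (Complex.I * z * x)
    have h : ‖Complex.I * z * x‖ = ‖z‖ * |x| := by simp
    have h2 : ‖Complex.I * (x : ℂ)‖ = |x| := by simp
    rw [h] at h1
    rw [h2]
    calc _ ≤ ‖z‖ * |x| * Real.exp (‖z‖ * |x|) * |x| := by gcongr
      _ ≤ (‖z₀‖ + 1) * |x| * Real.exp ((‖z₀‖ + 1) * ε) * |x| := by gcongr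
      _ = _ := by rw [← sq_abs x]; ring
  · refine Eventually.of_forall fun x z _ => ?_
    have h : HasDerivAt (fun z : ℂ => Complex.I * z * x) (Complex.I * x) z := by
      simpa using ((hasDerivAt_id z).const_mul Complex.I).mul_const (x : ℂ)
    exact (h.cexp.sub_const 1).sub h

theorem integrable_one_sub_cos (hint : Integrable (fun x => x ^ 2) μ) (a : ℝ) :
    Integrable (fun x : ℝ => 1 - Real.cos (a * x)) μ := by
  refine (hint.const_mul (a ^ 2 / 2)).mono' (by fun_prop) (Eventually.of_forall fun x => ?_)
  rw [Real.norm_eq_abs, abs_of_nonneg (by linarith [Real.cos_le_one (a * x)])]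
  nlinarith [Real.one_sub_sq_div_two_le_cos (x := a * x)]

/-- The real part is exactly (e^(-bx) - 1 + bx) - e^(-bx)(1 - cos(ax)). The first bracket is
quadratic in bx, and the tilt in the second is at least e⁻¹. -/
theorem re_compensated_le {a b x : ℝ} (h : |b * x| ≤ 1) :
    (Complex.exp (Complex.I * (a + b * Complex.I) * x) - 1
      - Complex.I * (a + b * Complex.I) * x).re
      ≤ b ^ 2 * x ^ 2 - Real.exp (-1) * (1 - Real.cos (a * x)) := by
  have e : Complex.I * (a + b * Complex.I) * x = ((-(b * x) : ℝ) : ℂ) + (a * x : ℝ) * Complex.I := by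
    push_cast
    linear_combination (b * x : ℂ) * Complex.I_sq
  rw [e]
  have h1 : (Complex.exp (((-(b * x) : ℝ) : ℂ) + (a * x : ℝ) * Complex.I)).re
      = Real.exp (-(b * x)) * Real.cos (a * x) := by
    rw [Complex.exp_re]; simp
  have h2 : ((((-(b * x) : ℝ) : ℂ) + (a * x : ℝ) * Complex.I)).re = -(b * x) := by simp
  rw [Complex.sub_re, Complex.sub_re, h1, h2, Complex.one_re]
  have h3 := (abs_le.1 (Real.abs_exp_sub_one_sub_id_le (x := -(b * x)) (by rwa [abs_neg]))).2
  have h4 : Real.exp (-1) ≤ Real.exp (-(b * x)) := by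
    gcongr
    exact (abs_le.1 h).2
  nlinarith [mul_le_mul_of_nonneg_right h4 (by linarith [Real.cos_le_one (a * x)] :
    0 ≤ 1 - Real.cos (a * x))]

theorem re_compensatedExponent_le (hμ : ∀ᵐ x ∂μ, |x| ≤ ε)
    (hint : Integrable (fun x => x ^ 2) μ) {a b : ℝ} (hb : |b| * ε ≤ 1) :
    (compensatedExponent μ (a + b * Complex.I)).re
      ≤ b ^ 2 * ∫ x, x ^ 2 ∂μ - Real.exp (-1) * ∫ x, (1 - Real.cos (a * x)) ∂μ := by
  have hi := integrable_compensated hμ hint (a + b * Complex.I)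
  have hc := integrable_one_sub_cos hint a
  have h : (compensatedExponent μ (a + b * Complex.I)).re = ∫ x : ℝ,
      (Complex.exp (Complex.I * (a + b * Complex.I) * x) - 1
        - Complex.I * (a + b * Complex.I) * x).re ∂μ := (integral_re hi).symm
  rw [h, ← integral_const_mul, ← integral_const_mul,
    ← integral_sub (hint.const_mul _) (hc.const_mul _)]
  refine integral_mono_ae hi.re ((hint.const_mul _).sub (hc.const_mul _)) ?_
  filter_upwards [hμ] with x hx
  refine re_compensated_le ?_
  rw [abs_mul]
  exact (mul_le_mul_of_nonneg_left hx (abs_nonneg b)).trans hb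

theorem sq_div_five_le_one_sub_cos {y : ℝ} (hy : |y| ≤ 1) : y ^ 2 / 5 ≤ 1 - Real.cos y := by
  have h := Real.cos_le_one_sub_mul_cos_sq (x := y) (hy.trans (by linarith [Real.pi_gt_three]))
  have h2 : (1 / 5 : ℝ) ≤ 2 / Real.pi ^ 2 := by
    rw [div_le_div_iff₀ (by norm_num) (by positivity)]
    nlinarith [Real.pi_gt_three, Real.pi_lt_d2]
  nlinarith [mul_le_mul_of_nonneg_right h2 (sq_nonneg y)]

theorem sq_mul_integral_le_integral_one_sub_cos (hint : Integrable (fun x => x ^ 2) μ)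
    {a δ : ℝ} (ha : 0 ≤ a) (h : a * δ ≤ 1) :
    a ^ 2 / 5 * ∫ x in Icc (-δ) δ, x ^ 2 ∂μ ≤ ∫ x, (1 - Real.cos (a * x)) ∂μ := by
  have hc := integrable_one_sub_cos hint a
  rw [← integral_const_mul]
  refine le_trans (setIntegral_mono_on (hint.const_mul _).integrableOn hc.integrableOn
    measurableSet_Icc fun x hx => ?_) (setIntegral_le_integral hc
      (Eventually.of_forall fun x => sub_nonneg.2 (Real.cos_le_one _)))
  have := sq_div_five_le_one_sub_cos (y := a * x) (by
    rw [abs_mul, abs_of_nonneg ha]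
    exact (mul_le_mul_of_nonneg_left (abs_le.2 hx) ha).trans h)
  nlinarith

/-! ### Lévy measures and their truncations. -/

/-- Weighting by x² ∧ 1, positive off the null set {0}, gives a finite measure; dividing the weight
out again keeps σ-finiteness. The Radon–Nikodym arguments below rely on this. -/
theorem IsLevyMeasure.sigmaFinite {ν : Measure ℝ} (hν : IsLevyMeasure ν) : SigmaFinite ν := by
  have hm : Measurable fun x : ℝ => ENNReal.ofReal (min (x ^ 2) 1) := by fun_prop
  have hfin : IsFiniteMeasure (ν.withDensity fun x : ℝ => ENNReal.ofReal (min (x ^ 2) 1)) :=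
    isFiniteMeasure_withDensity hν.lintegral_lt_top.ne
  have h0 : ∀ᵐ x ∂ν, x ≠ 0 := by simpa [ae_iff] using hν.zero
  have hpos : ∀ᵐ x ∂ν, ENNReal.ofReal (min (x ^ 2) 1) ≠ 0 := by
    filter_upwards [h0] with x hx
    rw [← pos_iff_ne_zero, ENNReal.ofReal_pos]
    positivity
  rw [← withDensity_inv_same hm hpos (Eventually.of_forall fun _ => ENNReal.ofReal_ne_top)]
  refine SigmaFinite.withDensity_of_ne_top ?_
  filter_upwards [(withDensity_absolutelyContinuous ν _).ae_le hpos] with x hx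
  simpa using hx

theorem IsLevyMeasure.integrable_sq {ν : Measure ℝ} (hν : IsLevyMeasure ν) (ε : ℝ) :
    Integrable (fun x => x ^ 2) (smallJumpMeasure ν ε) := by
  have h : Integrable (fun x : ℝ => min (x ^ 2) 1) ν := by
    refine ⟨by fun_prop, ?_⟩
    rw [hasFiniteIntegral_iff_ofReal (Eventually.of_forall fun x => by positivity)]
    exact hν.lintegral_lt_top
  refine ((h.mono_measure Measure.restrict_le_self).const_mul (1 + ε ^ 2)).mono' (by fun_prop) ?_
  refine (ae_restrict_mem measurableSet_Icc).mono fun x hx => ?_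
  have hx2 : x ^ 2 ≤ ε ^ 2 := sq_le_sq' hx.1 hx.2
  rw [Real.norm_of_nonneg (sq_nonneg x)]
  rcases le_total (x ^ 2) 1 with h1 | h1
  · rw [min_eq_left h1]
    nlinarith [mul_nonneg (sq_nonneg x) (sq_nonneg ε)]
  · rw [min_eq_right h1]
    linarith

theorem ae_abs_le_smallJumpMeasure (ν : Measure ℝ) (ε : ℝ) :
    ∀ᵐ x ∂(smallJumpMeasure ν ε), |x| ≤ ε :=
  (ae_restrict_mem measurableSet_Icc).mono fun _ hx => abs_le.2 hx

theorem smallJumpMeasure_smallJumpMeasure (ν : Measure ℝ) {δ ε : ℝ} (h : δ ≤ ε) :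
    smallJumpMeasure (smallJumpMeasure ν ε) δ = smallJumpMeasure ν δ := by
  rw [smallJumpMeasure, smallJumpMeasure, Measure.restrict_restrict measurableSet_Icc,
    inter_eq_left.2 (Icc_subset_Icc (neg_le_neg h) h), smallJumpMeasure]

/-! ### Consequences of the stable-like density bounds. -/

section StableLike

variable {β cplus cminus ε : ℝ} {ν : Measure ℝ}

theorem div_rpow_mul_sq (c : ℝ) {x : ℝ} (hx : x ≠ 0) :
    c / |x| ^ (β + 1) * x ^ 2 = c * |x| ^ (1 - β) := by
  have h := abs_pos.2 hx
  rw [← sq_abs x, ← Real.rpow_natCast |x| 2, div_mul_eq_mul_div, mul_div_assoc,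
    ← Real.rpow_sub h]
  congr 2
  push_cast
  ring

theorem stableLike_density_mul_sq (hcm : 0 < cminus)
    (hdens : ∀ᵐ x : ℝ, x ∈ Icc (-ε) ε → x ≠ 0 →
          ENNReal.ofReal (cminus / |x| ^ (β + 1)) ≤ ν.rnDeriv volume x ∧
          ν.rnDeriv volume x ≤ ENNReal.ofReal (cplus / |x| ^ (β + 1))) (hcp : cminus < cplus) :
    ∀ᵐ x : ℝ, x ∈ Icc (-ε) ε →
      cminus * |x| ^ (1 - β) ≤ (ν.rnDeriv volume x).toReal * x ^ 2 ∧
      (ν.rnDeriv volume x).toReal * x ^ 2 ≤ cplus * |x| ^ (1 - β) := by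
  filter_upwards [hdens, Measure.ae_ne volume 0] with x h h0 hx
  obtain ⟨h1, h2⟩ := h hx h0
  have hp : 0 ≤ cplus / |x| ^ (β + 1) := div_nonneg (hcm.trans hcp).le (by positivity)
  rw [← div_rpow_mul_sq cminus h0, ← div_rpow_mul_sq cplus h0]
  constructor
  · gcongr
    exact (ENNReal.ofReal_le_iff_le_toReal (ne_top_of_le_ne_top ENNReal.ofReal_ne_top h2)).1 h1
  · gcongr
    exact ENNReal.toReal_le_of_le_ofReal hp h2

theorem setIntegral_abs_rpow_scale {p δ : ℝ} (hδ : 0 < δ) (hε : 0 < ε) :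
    ∫ x in Icc (-δ) δ, |x| ^ p = (δ / ε) ^ (p + 1) * ∫ x in Icc (-ε) ε, |x| ^ p := by
  have hr : 0 < δ / ε := by positivity
  rw [integral_Icc_eq_integral_Ioc, integral_Icc_eq_integral_Ioc,
    ← intervalIntegral.integral_of_le (by linarith), ← intervalIntegral.integral_of_le (by linarith)]
  have h := intervalIntegral.smul_integral_comp_mul_left (a := -ε) (b := ε)
    (fun x : ℝ => |x| ^ p) (δ / ε)
  have e1 : δ / ε * ε = δ := by field_simp
  rw [mul_neg, e1] at h
  rw [← h, smul_eq_mul, Real.rpow_add_one hr.ne', ← intervalIntegral.integral_const_mul,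
    ← intervalIntegral.integral_const_mul]
  refine intervalIntegral.integral_congr fun x _ => ?_
  simp only [abs_mul, abs_of_pos hr, Real.mul_rpow hr.le (abs_nonneg x)]
  ring

/-- Both variances are compared with integrals of |x|^(1-β), whose homogeneity gives the power of
δ/ε without evaluating them. -/
theorem sigmaSq_lower_bound (hν : IsLevyMeasure ν) (hac : ν ≪ volume) (hε : 0 < ε)
    (hcm : 0 < cminus) (hcp : cminus < cplus)
    (hdens : ∀ᵐ x : ℝ, x ∈ Icc (-ε) ε → x ≠ 0 →
          ENNReal.ofReal (cminus / |x| ^ (β + 1)) ≤ ν.rnDeriv volume x ∧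
          ν.rnDeriv volume x ≤ ENNReal.ofReal (cplus / |x| ^ (β + 1)))
    {δ : ℝ} (hδ : 0 < δ) (hδε : δ ≤ ε) :
    cminus / cplus * (δ / ε) ^ (2 - β) * sigmaSq ν ε ≤ sigmaSq ν δ := by
  have := hν.sigmaFinite
  have hd := stableLike_density_mul_sq hcm hdens hcp
  have hcp0 := hcm.trans hcp
  have hsub : Icc (-δ) δ ⊆ Icc (-ε) ε := Icc_subset_Icc (neg_le_neg hδε) hδε
  have hsig : ∀ η, sigmaSq ν η =
      ∫ x in Icc (-η) η, (ν.rnDeriv volume x).toReal * x ^ 2 := fun η =>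
    (setIntegral_rnDeriv_smul hac measurableSet_Icc).symm
  have hi : IntegrableOn (fun x => (ν.rnDeriv volume x).toReal * x ^ 2) (Icc (-ε) ε) := by
    have h := hν.integrable_sq ε
    rw [smallJumpMeasure, ← IntegrableOn, ← integrable_indicator_iff measurableSet_Icc,
      ← integrable_rnDeriv_smul_iff hac] at h
    rw [← integrable_indicator_iff measurableSet_Icc]
    refine h.congr (Eventually.of_forall fun x => ?_)
    by_cases hx : x ∈ Icc (-ε) ε <;> simp [indicator, hx]
  -- Integrability is inherited from the finite variance through the lower density bound, so β < 2
  -- is not needed here.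
  have hp : IntegrableOn (fun x : ℝ => |x| ^ (1 - β)) (Icc (-ε) ε) := by
    refine (hi.const_mul cminus⁻¹).mono'
      (continuous_abs.measurable.pow_const _).aestronglyMeasurable ?_
    rw [ae_restrict_iff' measurableSet_Icc]
    filter_upwards [hd] with x hx hxm
    rw [Real.norm_of_nonneg (by positivity), ← div_eq_inv_mul, le_div_iff₀' hcm]
    exact (hx hxm).1
  have hlow : cminus * ∫ x in Icc (-δ) δ, |x| ^ (1 - β) ≤ sigmaSq ν δ := by
    rw [hsig, ← integral_const_mul]
    refine setIntegral_mono_on_ae ((hp.mono_set hsub).const_mul _) (hi.mono_set hsub)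
      measurableSet_Icc ?_
    filter_upwards [hd] with x hx hxm using (hx (hsub hxm)).1
  have hup : sigmaSq ν ε ≤ cplus * ∫ x in Icc (-ε) ε, |x| ^ (1 - β) := by
    rw [hsig, ← integral_const_mul]
    refine setIntegral_mono_on_ae hi (hp.const_mul _) measurableSet_Icc ?_
    filter_upwards [hd] with x hx hxm using (hx hxm).2
  rw [setIntegral_abs_rpow_scale hδ hε, show 1 - β + 1 = 2 - β by ring] at hlow
  refine le_trans ?_ hlow
  calc cminus / cplus * (δ / ε) ^ (2 - β) * sigmaSq ν ε
      ≤ cminus / cplus * (δ / ε) ^ (2 - β) * (cplus * ∫ x in Icc (-ε) ε, |x| ^ (1 - β)) := by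
        gcongr
    _ = _ := by field_simp

theorem measure_Ioo_le_totalJumpIntensity (μ : Measure ℝ) (ε : ℝ) :
    μ (Ioo 0 ε) ≤ totalJumpIntensity μ ε := by
  have hmono : Monotone fun m : ℕ => {x : ℝ | 1 / ((m : ℝ) + 1) < |x| ∧ |x| < ε} :=
    fun m k hmk x hx => ⟨(Nat.one_div_le_one_div hmk).trans_lt hx.1, hx.2⟩
  have hsub : Ioo 0 ε ⊆ ⋃ m : ℕ, {x : ℝ | 1 / ((m : ℝ) + 1) < |x| ∧ |x| < ε} := by
    intro x hx
    obtain ⟨m, hm⟩ := exists_nat_one_div_lt hx.1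
    exact mem_iUnion.2 ⟨m, by simpa [abs_of_pos hx.1] using ⟨by simpa using hm, hx.2⟩⟩
  refine (measure_mono hsub).trans ?_
  rw [hmono.measure_iUnion]
  exact iSup_le fun m => le_iSup₂_of_le (1 / ((m : ℝ) + 1)) (by positivity) le_rfl

/-- Finite mass would make x^(-β-1) integrable at 0, which fails for β > 0. -/
theorem measure_Ioo_eq_top (hν : IsLevyMeasure ν) (hac : ν ≪ volume) (hβ : 0 < β) (hε : 0 < ε)
    (hcm : 0 < cminus)
    (hdens : ∀ᵐ x : ℝ, x ∈ Icc (-ε) ε → x ≠ 0 →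
      ENNReal.ofReal (cminus / |x| ^ (β + 1)) ≤ ν.rnDeriv volume x) :
    ν (Ioo 0 ε) = ∞ := by
  have := hν.sigmaFinite
  by_contra hfin
  have hle : ∫⁻ x in Ioo 0 ε, ENNReal.ofReal (cminus * x ^ (-(β + 1))) ≤ ν (Ioo 0 ε) := by
    rw [← Measure.setLIntegral_rnDeriv hac]
    refine setLIntegral_mono_ae' measurableSet_Ioo ?_
    filter_upwards [hdens] with x hx hxm
    have h := hx ⟨by linarith [hxm.1], hxm.2.le⟩ hxm.1.ne'
    rwa [abs_of_pos hxm.1, div_eq_mul_inv, ← Real.rpow_neg hxm.1.le] at h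
  have hi : IntegrableOn (fun x : ℝ => cminus * x ^ (-(β + 1))) (Ioo 0 ε) := by
    refine ⟨by fun_prop, ?_⟩
    rw [hasFiniteIntegral_iff_ofReal]
    · exact hle.trans_lt (lt_top_iff_ne_top.2 hfin)
    · refine (ae_restrict_mem measurableSet_Ioo).mono fun x hx => ?_
      have := hx.1
      simp only [Pi.zero_apply]
      positivity
  have h2 : IntegrableOn (fun x : ℝ => x ^ (-(β + 1))) (Ioo 0 ε) := by
    have h := hi.const_mul cminus⁻¹
    simpa [IntegrableOn, inv_mul_cancel_left₀ hcm.ne'] using h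
  rw [intervalIntegral.integrableOn_Ioo_rpow_iff hε] at h2
  linarith

theorem noJumpProb_eq_zero (hν : IsLevyMeasure ν) (hac : ν ≪ volume) (hβ : 0 < β) (hε : 0 < ε)
    (hcm : 0 < cminus)
    (hdens : ∀ᵐ x : ℝ, x ∈ Icc (-ε) ε → x ≠ 0 →
      ENNReal.ofReal (cminus / |x| ^ (β + 1)) ≤ ν.rnDeriv volume x) (Δ : ℝ) :
    noJumpProb (smallJumpMeasure ν ε) ε Δ = 0 := by
  refine if_pos (top_unique ?_)
  rw [← measure_Ioo_eq_top hν hac hβ hε hcm hdens]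
  refine le_trans (le_of_eq ?_) (measure_Ioo_le_totalJumpIntensity _ ε)
  rw [smallJumpMeasure, Measure.restrict_apply measurableSet_Ioo, inter_eq_left.2]
  exact fun x hx => ⟨by linarith [hx.1], hx.2.le⟩

end StableLike

/-! ### The characteristic function as the exponential of an entire function. -/

/-- Compensating all jumps instead of those with |x| ≤ 1 shifts the drift by the integral of x over
|x| > 1. As μ lives on [-ε, ε], this is the shift in `drift`; both are zero when ε ≤ 1. -/
theorem levyExponent_eq_compensatedExponent (b sig : ℝ) {μ : Measure ℝ} {ε : ℝ}
    (hμ : ∀ᵐ x ∂μ, |x| ≤ ε) (hint : Integrable (fun x => x ^ 2) μ) (u : ℝ) :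
    levyExponent b sig μ u = Complex.I * u * drift b μ ε
      - (sig : ℂ) ^ 2 * (u : ℂ) ^ 2 / 2 + compensatedExponent μ u := by
  have hi := integrable_compensated hμ hint u
  have hbig : IntegrableOn (fun x : ℝ => x) {x : ℝ | 1 < |x|} μ := by
    refine hint.integrableOn.mono' (by fun_prop) ?_
    refine (ae_restrict_mem (measurableSet_lt (by fun_prop) (by fun_prop))).mono fun x hx => ?_
    rw [Real.norm_eq_abs, ← sq_abs x]
    have hx' : 1 < |x| := hx
    nlinarith
  have hbigm : MeasurableSet {x : ℝ | 1 < |x|} := measurableSet_lt (by fun_prop) (by fun_prop)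
  have hdrift : drift b μ ε = b + ∫ x in {x : ℝ | 1 < |x|}, x ∂μ := by
    rw [drift]
    congr 1
    split_ifs with hε
    · have h1 : μ {x : ℝ | ε < |x| ∧ |x| ≤ 1} = 0 :=
        measure_mono_null (fun x hx => not_le.2 hx.1) (ae_iff.1 hμ)
      have h2 : μ {x : ℝ | 1 < |x|} = 0 :=
        measure_mono_null (fun x hx => not_le.2 (hε.trans_lt hx)) (ae_iff.1 hμ)
      rw [setIntegral_measure_zero _ h1, setIntegral_measure_zero _ h2, neg_zero]
    · refine setIntegral_congr_set ?_
      filter_upwards [hμ] with x hx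
      exact propext ⟨fun h => h.1, fun h => ⟨h, hx⟩⟩
  have hsplit : ∫ x : ℝ, (Complex.exp (Complex.I * u * x) - 1 -
      (if |x| ≤ 1 then Complex.I * u * x else 0)) ∂μ = compensatedExponent μ u
        + Complex.I * u * ∫ x in {x : ℝ | 1 < |x|}, (x : ℂ) ∂μ := by
    rw [compensatedExponent, ← integral_const_mul, ← integral_indicator hbigm, ← integral_add hi]
    · refine integral_congr_ae (Eventually.of_forall fun x => ?_)
      by_cases hx : |x| ≤ 1
      · simp [hx]
      · simp [hx, not_le.1 hx]
    · exact (integrable_indicator_iff hbigm).2 (hbig.ofReal.const_mul _)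
  have hcast : ∫ x in {x : ℝ | 1 < |x|}, (x : ℂ) ∂μ =
      ((∫ x in {x : ℝ | 1 < |x|}, x ∂μ : ℝ) : ℂ) := integral_ofReal
  rw [levyExponent, hsplit, hdrift, hcast]
  push_cast
  ring

/-- The characteristic exponent of the rescaled increment at complex `z`, with scale `s`. -/
noncomputable def scaledExponent (sig Δ s : ℝ) (μ : Measure ℝ) (z : ℂ) : ℂ :=
  Δ * (-((sig : ℂ) ^ 2 * (z / s) ^ 2 / 2) + compensatedExponent μ (z / s))

theorem integral_exp_rescaledIncrement {Ω : Type*} [MeasurableSpace Ω] {P : Measure Ω}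
    {X : ℝ≥0 → Ω → ℝ} {b sig ε : ℝ} {μ : Measure ℝ} (hX : HasLevyTriplet X P b sig μ)
    (hμ : ∀ᵐ x ∂μ, |x| ≤ ε) (hint : Integrable (fun x => x ^ 2) μ) (Δ : ℝ≥0) (t : ℝ) :
    ∫ ω, Complex.exp (Complex.I * t * rescaledIncrement X b sig μ ε Δ ω) ∂P =
      Complex.exp (scaledExponent sig Δ (Real.sqrt (Δ * (sig ^ 2 + sigmaSq μ ε))) μ t) := by
  set s := Real.sqrt (Δ * (sig ^ 2 + sigmaSq μ ε)) with hs
  have h1 : ∀ ω, Complex.exp (Complex.I * t * rescaledIncrement X b sig μ ε Δ ω) =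
      Complex.exp (-(Complex.I * (t / s : ℝ) * Δ * drift b μ ε)) *
        Complex.exp ((t / s : ℝ) * X Δ ω * Complex.I) := fun ω => by
    rw [← Complex.exp_add, rescaledIncrement, ← hs]
    congr 1
    push_cast
    ring
  have h2 : ∫ ω, Complex.exp ((t / s : ℝ) * X Δ ω * Complex.I) ∂P =
      charFun (P.map (X Δ)) (t / s) := by
    rw [charFun_apply_real, integral_map (hX.measurable Δ).aemeasurable (by fun_prop)]
  simp_rw [h1]
  rw [integral_const_mul, h2, hX.charFun_eq, ← Complex.exp_add,
    levyExponent_eq_compensatedExponent b sig hμ hint, scaledExponent]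
  congr 1
  push_cast
  ring

theorem differentiable_scaledExponent (sig Δ s : ℝ) {μ : Measure ℝ} {ε : ℝ}
    (hμ : ∀ᵐ x ∂μ, |x| ≤ ε) (hint : Integrable (fun x => x ^ 2) μ) :
    Differentiable ℂ (scaledExponent sig Δ s μ) := by
  have h := differentiable_compensatedExponent hμ hint
  have h' : Differentiable ℂ fun z : ℂ => compensatedExponent μ (z / s) :=
    h.comp (differentiable_id.div_const _)
  unfold scaledExponent
  fun_prop

theorem contDiff_comp_ofReal {f : ℂ → ℂ} (hf : Differentiable ℂ f) {n : WithTop ℕ∞} :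
    ContDiff ℝ n fun t : ℝ => f t :=
  (hf.contDiff.restrict_scalars ℝ).comp Complex.ofRealCLM.contDiff

theorem iteratedDeriv_comp_ofReal {f : ℂ → ℂ} (hf : Differentiable ℂ f) (k : ℕ) :
    iteratedDeriv k (fun t : ℝ => f t) = fun t : ℝ => iteratedDeriv k f t := by
  induction k with
  | zero => simp
  | succ k ih =>
    rw [iteratedDeriv_succ, ih, iteratedDeriv_succ]
    ext t
    have h : ContDiff ℂ (k + 1 : ℕ) f := hf.contDiff
    exact ((h.differentiable_iteratedDeriv k (by exact_mod_cast k.lt_succ_self)).differentiableAt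
      (x := (t : ℂ))).hasDerivAt.comp_ofReal.deriv

/-! ### Decay of the exponent off the real axis. -/

theorem one_sub_cos_lower_bound {β ε sig q : ℝ} {ν : Measure ℝ} (hν : IsLevyMeasure ν)
    (hβ : β < 2) (hε : 0 < ε) (hq1 : q ≤ 1)
    (hsig : ∀ δ, 0 < δ → δ ≤ ε → q * (δ / ε) ^ (2 - β) * sigmaSq ν ε ≤ sigmaSq ν δ)
    {a : ℝ} (ha : 0 < a) :
    q / 5 * a ^ 2 * max 1 (a * ε) ^ (β - 2) * (sig ^ 2 + sigmaSq ν ε)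
      ≤ sig ^ 2 * a ^ 2 / 2 + ∫ x, (1 - Real.cos (a * x)) ∂(smallJumpMeasure ν ε) := by
  have key : ∀ δ, δ ≤ ε → a * δ ≤ 1 → a ^ 2 / 5 * sigmaSq ν δ
      ≤ ∫ x, (1 - Real.cos (a * x)) ∂(smallJumpMeasure ν ε) := fun δ hδ h => by
    have := sq_mul_integral_le_integral_one_sub_cos (hν.integrable_sq ε) ha.le h
    rw [← smallJumpMeasure, smallJumpMeasure_smallJumpMeasure ν hδ] at this
    exact this
  have hσ : 0 ≤ sigmaSq ν ε := integral_nonneg fun x => sq_nonneg x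
  have hpow1 : max 1 (a * ε) ^ (β - 2) ≤ 1 :=
    Real.rpow_le_one_of_one_le_of_nonpos (le_max_left _ _) (by linarith)
  have hpow0 : 0 ≤ max 1 (a * ε) ^ (β - 2) := by positivity
  set w := max 1 (a * ε) ^ (β - 2) with hw
  have hqw : q * w ≤ 1 := mul_le_one₀ hq1 hpow0 hpow1
  have hgauss : q / 5 * a ^ 2 * w * sig ^ 2 ≤ sig ^ 2 * a ^ 2 / 2 := by
    nlinarith [mul_le_mul_of_nonneg_right hqw (by positivity : 0 ≤ a ^ 2 * sig ^ 2),
      (by positivity : 0 ≤ a ^ 2 * sig ^ 2)]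
  have hjump : q / 5 * a ^ 2 * w * sigmaSq ν ε
      ≤ ∫ x, (1 - Real.cos (a * x)) ∂(smallJumpMeasure ν ε) := by
    rcases le_total (a * ε) 1 with h | h
    · refine le_trans ?_ (key ε le_rfl h)
      nlinarith [mul_le_mul_of_nonneg_right hqw (by positivity : 0 ≤ a ^ 2 * sigmaSq ν ε)]
    -- At high frequency only jumps with |x| ≤ 1/a are kept: there 1 - cos(ax) is still comparable
    -- to (ax)².
    · have h1 : a⁻¹ ≤ ε := by rwa [inv_le_iff_one_le_mul₀' ha]
      refine le_trans ?_ (key a⁻¹ h1 (mul_inv_cancel₀ ha.ne').le)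
      have h2 := hsig a⁻¹ (inv_pos.2 ha) h1
      have h3 : (a⁻¹ / ε) ^ (2 - β) = w := by
        rw [hw, max_eq_right h, div_eq_mul_inv, ← mul_inv,
          Real.inv_rpow (by positivity), ← Real.rpow_neg (by positivity), neg_sub]
      rw [h3] at h2
      nlinarith [mul_le_mul_of_nonneg_left h2 (by positivity : 0 ≤ a ^ 2 / 5)]
  linarith

theorem re_scaledExponent_le {β ε sig q Δ s : ℝ} {ν : Measure ℝ} (hν : IsLevyMeasure ν)
    (hβ : β < 2) (hε : 0 < ε) (hq1 : q ≤ 1) (hΔ : 0 ≤ Δ)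
    (hsig : ∀ δ, 0 < δ → δ ≤ ε → q * (δ / ε) ^ (2 - β) * sigmaSq ν ε ≤ sigmaSq ν δ)
    (hs : 0 < s) (hs2 : s ^ 2 = Δ * (sig ^ 2 + sigmaSq ν ε))
    {t w : ℝ} (ht : 0 < t) (hw : |w| * (ε / s) ≤ 1) :
    (scaledExponent sig Δ s (smallJumpMeasure ν ε) (t + w * Complex.I)).re
      ≤ w ^ 2 - Real.exp (-1) * (q / 5) * (t ^ 2 * max 1 (t * (ε / s)) ^ (β - 2)) := by
  set μ := smallJumpMeasure ν ε
  have hz : ((t : ℂ) + w * Complex.I) / s = (t / s : ℝ) + (w / s : ℝ) * Complex.I := by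
    push_cast; ring
  have hb : |w / s| * ε ≤ 1 := by
    rw [abs_div, abs_of_pos hs]
    calc |w| / s * ε = |w| * (ε / s) := by ring
      _ ≤ 1 := hw
  have h1 := re_compensatedExponent_le (ae_abs_le_smallJumpMeasure ν ε) (hν.integrable_sq ε)
    (a := t / s) hb
  have h2 := one_sub_cos_lower_bound (sig := sig) hν hβ hε hq1 hsig (div_pos ht hs)
  rw [show t / s * ε = t * (ε / s) by ring] at h2
  have hg : (-((sig : ℂ) ^ 2 * ((t / s : ℝ) + (w / s : ℝ) * Complex.I) ^ 2 / 2)).re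
      = -(sig ^ 2 * ((t / s) ^ 2 - (w / s) ^ 2) / 2) := by
    have : (-((sig : ℂ) ^ 2 * ((t / s : ℝ) + (w / s : ℝ) * Complex.I) ^ 2 / 2))
        = ((-(sig ^ 2 * ((t / s) ^ 2 - (w / s) ^ 2) / 2) : ℝ) : ℂ)
          + ((-(sig ^ 2 * (t / s) * (w / s)) : ℝ) : ℂ) * Complex.I := by
      push_cast
      linear_combination (-((sig : ℂ) ^ 2 * (w / s) ^ 2 / 2)) * Complex.I_sq
    rw [this, Complex.add_re, Complex.re_ofReal_mul, Complex.ofReal_re]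
    simp
  rw [scaledExponent, hz, Complex.re_ofReal_mul, Complex.add_re, hg]
  have he : Real.exp (-1) ≤ 1 := Real.exp_le_one_iff.2 (by norm_num)
  have he0 := Real.exp_pos (-1)
  set J := ∫ x, (1 - Real.cos (t / s * x)) ∂μ
  set m := max 1 (t * (ε / s)) ^ (β - 2)
  have h3 : -(sig ^ 2 * ((t / s) ^ 2 - (w / s) ^ 2) / 2)
      + (compensatedExponent μ ((t / s : ℝ) + (w / s : ℝ) * Complex.I)).re
      ≤ (w / s) ^ 2 * (sig ^ 2 + sigmaSq ν ε)
        - Real.exp (-1) * (q / 5 * (t / s) ^ 2 * m * (sig ^ 2 + sigmaSq ν ε)) := by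
    have h4 := mul_le_mul_of_nonneg_left h2 he0.le
    have h5 : Real.exp (-1) * (sig ^ 2 * (t / s) ^ 2 / 2) ≤ sig ^ 2 * (t / s) ^ 2 / 2 :=
      mul_le_of_le_one_left (by positivity) he
    have h6 : 0 ≤ sig ^ 2 * (w / s) ^ 2 := by positivity
    have h7 : ∫ x, x ^ 2 ∂μ = sigmaSq ν ε := rfl
    rw [h7] at h1
    linarith
  refine (mul_le_mul_of_nonneg_left h3 hΔ).trans (le_of_eq ?_)
  calc Δ * ((w / s) ^ 2 * (sig ^ 2 + sigmaSq ν ε)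
        - Real.exp (-1) * (q / 5 * (t / s) ^ 2 * m * (sig ^ 2 + sigmaSq ν ε)))
      = (Δ * (sig ^ 2 + sigmaSq ν ε)) *
        ((w / s) ^ 2 - Real.exp (-1) * (q / 5) * (t / s) ^ 2 * m) := by ring
    -- The normalisation s² = Δ(sig² + σ²) cancels the variance, leaving constants free of Δ, ε and
    -- sig.
    _ = _ := by rw [← hs2]; field_simp

/-- Each of A and t^β is separately a lower bound. If tM ≥ 1, the right side equals t^β M^(β-2) ≥
t^β, and it also dominates t²(tM)⁻² = M⁻² ≥ A. -/
theorem average_le_sq_mul_max_rpow {β t M A : ℝ} (hβ0 : 0 < β) (hβ2 : β < 2) (ht : 1 ≤ t)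
    (hM : 0 < M) (hM1 : M ≤ 1) (hA : A ≤ t ^ 2) (hAM : A * M ^ 2 ≤ 1) :
    (A + t ^ β) / 2 ≤ t ^ 2 * max 1 (t * M) ^ (β - 2) := by
  have ht0 : 0 < t := by linarith
  suffices A ≤ t ^ 2 * max 1 (t * M) ^ (β - 2) ∧ t ^ β ≤ t ^ 2 * max 1 (t * M) ^ (β - 2) by
    linarith [this.1, this.2]
  rcases le_total (t * M) 1 with h | h
  · rw [max_eq_left h, Real.one_rpow, mul_one]
    refine ⟨hA, ?_⟩
    rw [← Real.rpow_natCast t 2]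
    exact Real.rpow_le_rpow_of_exponent_le ht (by push_cast; linarith)
  · rw [max_eq_right h]
    constructor
    · have h1 : (t * M) ^ (-2 : ℝ) ≤ (t * M) ^ (β - 2) :=
        Real.rpow_le_rpow_of_exponent_le h (by linarith)
      have h2 : t ^ 2 * (t * M) ^ (-2 : ℝ) = (M ^ 2)⁻¹ := by
        rw [Real.rpow_neg (by positivity), Real.rpow_two]
        field_simp
      have h3 : A ≤ (M ^ 2)⁻¹ := by
        rw [← one_div, le_div_iff₀ (by positivity)]
        exact hAM
      exact (h3.trans h2.ge).trans (by gcongr)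
    · rw [Real.mul_rpow ht0.le hM.le, ← mul_assoc, ← Real.rpow_two, ← Real.rpow_add ht0,
        add_sub_cancel]
      exact le_mul_of_one_le_right (by positivity)
        (Real.one_le_rpow_of_pos_of_le_one_of_nonpos hM hM1 (by linarith))

/-! ### Cauchy estimates and tail integrals. -/

theorem exists_exp_neg_rpow_le {a β : ℝ} (ha : 0 < a) (hβ : 0 < β) :
    ∃ l : ℝ, 0 ≤ l ∧ ∀ t : ℝ, 2 ≤ t → Real.exp (-(a * (t / 2) ^ β)) ≤ Real.exp l * t ^ (-2 : ℝ) := by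
  -- The m-th Taylor term of `exp` suffices once βm ≥ 2.
  obtain ⟨m, hm⟩ := exists_nat_ge (2 / β)
  set K : ℝ := m.factorial / a ^ m * 4
  refine ⟨max 0 (Real.log K), le_max_left _ _, fun t ht => ?_⟩
  have ht0 : 0 < t := by linarith
  have hK : K ≤ Real.exp (max 0 (Real.log K)) := by
    have hK0 : 0 < K := by positivity
    calc K = Real.exp (Real.log K) := (Real.exp_log hK0).symm
      _ ≤ _ := Real.exp_le_exp.2 (le_max_right _ _)
  have hmβ : 2 ≤ β * m := by
    rw [div_le_iff₀ hβ] at hm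
    linarith
  have h1 := Real.pow_div_factorial_le_exp (a * (t / 2) ^ β) (by positivity) m
  have h2 : (t / 2) ^ 2 ≤ ((t / 2) ^ β) ^ m := by
    rw [← Real.rpow_two, ← Real.rpow_mul_natCast (by positivity)]
    exact Real.rpow_le_rpow_of_exponent_le (by linarith) hmβ
  have h3 : a ^ m * (t / 2) ^ 2 / m.factorial ≤ Real.exp (a * (t / 2) ^ β) := by
    refine le_trans ?_ h1
    rw [mul_pow]
    gcongr
  rw [Real.exp_neg]
  calc (Real.exp (a * (t / 2) ^ β))⁻¹ ≤ (a ^ m * (t / 2) ^ 2 / m.factorial)⁻¹ :=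
        inv_anti₀ (by positivity) h3
    _ = K * t ^ (-2 : ℝ) := by
        rw [Real.rpow_neg ht0.le, Real.rpow_two]
        simp only [K]
        field_simp
        norm_num
    _ ≤ _ := by gcongr

/-- Squaring Cauchy's bound gives (k!)² / R^(2k); one factor k! is absorbed by k! ≤ k^k ≤ R^(2k). -/
theorem sq_norm_iteratedDeriv_le {f : ℂ → ℂ} (hf : Differentiable ℂ f) {R B t : ℝ} {k : ℕ}
    (hR : 0 < R) (hk : (k : ℝ) ≤ R ^ 2) (hB : ∀ z ∈ Metric.sphere (t : ℂ) R, ‖f z‖ ≤ B) :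
    ‖iteratedDeriv k f t‖ ^ 2 ≤ k.factorial * B ^ 2 := by
  have h := Complex.norm_iteratedDeriv_le_of_forall_mem_sphere_norm_le k hR hf.diffContOnCl hB
  have hfac : (k.factorial : ℝ) ≤ (R ^ 2) ^ k :=
    calc (k.factorial : ℝ) ≤ (k : ℝ) ^ k := by exact_mod_cast Nat.factorial_le_pow k
      _ ≤ _ := by gcongr
  calc ‖iteratedDeriv k f t‖ ^ 2 ≤ (k.factorial * B / R ^ k) ^ 2 := by gcongr
    _ = k.factorial * B ^ 2 * (k.factorial / (R ^ 2) ^ k) := by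
        field_simp
        ring
    _ ≤ k.factorial * B ^ 2 * 1 := by
        gcongr
        exact div_le_one_of_le₀ hfac (by positivity)
    _ = _ := mul_one _

theorem integrableOn_and_integral_le_of_le_rpow_neg_two {f : ℝ → ℝ} (hf : Continuous f)
    {A T : ℝ} (hA : 0 ≤ A) (hT : 1 ≤ T) (h0 : ∀ t, 0 ≤ f t)
    (h : ∀ t, T ≤ t → f t ≤ A * t ^ (-2 : ℝ)) :
    IntegrableOn f (Ici T) ∧ ∫ t in Ici T, f t ≤ A := by
  have hT0 : 0 < T := by linarith
  have hi : IntegrableOn (fun t : ℝ => A * t ^ (-2 : ℝ)) (Ici T) := by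
    rw [integrableOn_Ici_iff_integrableOn_Ioi]
    exact (integrableOn_Ioi_rpow_of_lt (by norm_num) hT0).const_mul A
  have hfi : IntegrableOn f (Ici T) := by
    refine hi.mono' hf.aestronglyMeasurable ?_
    refine (ae_restrict_mem measurableSet_Ici).mono fun t ht => ?_
    rw [Real.norm_of_nonneg (h0 t)]
    exact h t ht
  refine ⟨hfi, (setIntegral_mono_on hfi hi measurableSet_Ici h).trans ?_⟩
  rw [integral_const_mul, integral_Ici_eq_integral_Ioi, integral_Ioi_rpow_of_lt (by norm_num) hT0]
  have : -T ^ ((-2 : ℝ) + 1) / (-2 + 1) = T ^ (-1 : ℝ) := by norm_num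
  rw [this, Real.rpow_neg_one]
  exact mul_le_of_le_one_right hA (inv_le_one_of_one_le₀ hT)

theorem one_le_logMax (n : ℕ) : 1 ≤ logMax n := by
  rw [logMax, Real.le_log_iff_exp_le (by positivity)]
  exact le_max_left _ _

theorem exp_neg_four_mul_logMax_le {n : ℕ} (hn : 1 ≤ n) :
    Real.exp (-(4 * logMax n)) ≤ (n : ℝ) ^ (-4 : ℤ) := by
  have hn0 : (0 : ℝ) < n := by exact_mod_cast hn
  have h : (n : ℝ) ≤ Real.exp (logMax n) := by
    rw [logMax, Real.exp_log (by positivity)]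
    exact le_max_right _ _
  rw [Real.exp_neg, zpow_neg]
  refine inv_anti₀ (by positivity) ?_
  calc (n : ℝ) ^ (4 : ℤ) = (n : ℝ) ^ 4 := by norm_cast
    _ ≤ Real.exp (logMax n) ^ 4 := by gcongr
    _ = _ := by rw [← Real.exp_nat_mul]; norm_num

theorem norm_exp_scaledExponent_le_on_sphere {β ε sig q Δ s c L : ℝ} {ν : Measure ℝ}
    (hν : IsLevyMeasure ν) (hβ0 : 0 < β) (hβ : β < 2) (hε : 0 < ε) (hq0 : 0 < q) (hq1 : q ≤ 1)
    (hΔ : 0 ≤ Δ)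
    (hsig : ∀ δ, 0 < δ → δ ≤ ε → q * (δ / ε) ^ (2 - β) * sigmaSq ν ε ≤ sigmaSq ν δ)
    (hs : 0 < s) (hs2 : s ^ 2 = Δ * (sig ^ 2 + sigmaSq ν ε))
    (hc : 42 ≤ c) (hL : 1 ≤ L) (hεs : (ε / s) ^ 2 * (c ^ 2 * L) ≤ 1)
    {t : ℝ} (ht : c * L ≤ t) {z : ℂ} (hz : z ∈ Metric.sphere (t : ℂ) (Real.sqrt (401 * L))) :
    ‖Complex.exp (scaledExponent sig Δ s (smallJumpMeasure ν ε) z)‖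
      ≤ Real.exp (401 * L
        - Real.exp (-1) * (q / 5) * ((c ^ 2 * L / 4 + (t / 2) ^ β) / 2)) := by
  set R := Real.sqrt (401 * L)
  have hR2 : R ^ 2 = 401 * L := Real.sq_sqrt (by positivity)
  have hR0 : 0 ≤ R := Real.sqrt_nonneg _
  have hM : 0 < ε / s := by positivity
  have hc2 : 42 ^ 2 ≤ c ^ 2 := by gcongr
  have hcL : 42 ≤ c * L := by nlinarith
  -- The threshold 42 is used here: 42² ≥ 4 · 401, so the circle stays in Re z ≥ t/2.
  have hRt : R ≤ t / 2 := by
    refine abs_le_of_sq_le_sq' ?_ (by linarith) |>.2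
    have h1 : (c * L) ^ 2 ≤ t ^ 2 := by gcongr
    have h2 : 42 ^ 2 * L ≤ (c * L) ^ 2 := by
      rw [mul_pow]
      gcongr
      nlinarith
    rw [hR2]
    linarith
  rw [mem_sphere_iff_norm] at hz
  have hre : |z.re - t| ≤ R := by simpa [hz] using Complex.abs_re_le_norm (z - t)
  have him : |z.im| ≤ R := by simpa [hz] using Complex.abs_im_le_norm (z - t)
  have hret : t / 2 ≤ z.re := by linarith [(abs_le.1 hre).1]
  have hre1 : 1 ≤ z.re := by linarith
  have hw : |z.im| * (ε / s) ≤ 1 := by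
    refine (mul_le_mul_of_nonneg_right him hM.le).trans ?_
    refine abs_le_of_sq_le_sq' ?_ zero_le_one |>.2
    rw [mul_pow, hR2]
    nlinarith [mul_le_mul_of_nonneg_left hc2 (by positivity : 0 ≤ (ε / s) ^ 2 * L)]
  have hM1 : ε / s ≤ 1 := by
    refine abs_le_of_sq_le_sq' ?_ zero_le_one |>.2
    have : 1 ≤ c ^ 2 * L := by nlinarith
    nlinarith [mul_le_mul_of_nonneg_left this (sq_nonneg (ε / s))]
  have hA : c ^ 2 * L / 4 ≤ z.re ^ 2 := by
    have h1 : (c * L / 2) ^ 2 ≤ z.re ^ 2 := by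
      gcongr
      linarith
    have h2 : c ^ 2 * L ≤ c ^ 2 * L ^ 2 := by
      gcongr
      nlinarith
    nlinarith
  have hgrow := average_le_sq_mul_max_rpow hβ0 hβ hre1 hM hM1 hA (by nlinarith)
  have hmain := re_scaledExponent_le (sig := sig) hν hβ hε hq1 hΔ hsig hs hs2
    (by linarith : 0 < z.re) hw
  rw [Complex.re_add_im] at hmain
  rw [Complex.norm_exp, Real.exp_le_exp]
  have hpow : (t / 2) ^ β ≤ z.re ^ β := by gcongr; linarith
  have hw2 : z.im ^ 2 ≤ 401 * L := by
    rw [← hR2, ← sq_abs z.im]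
    gcongr
  have hκ : 0 ≤ Real.exp (-1) * (q / 5) := by positivity
  have := mul_le_mul_of_nonneg_left
    ((by linarith : (c ^ 2 * L / 4 + (t / 2) ^ β) / 2 ≤ (c ^ 2 * L / 4 + z.re ^ β) / 2).trans
      hgrow) hκ
  linarith

end SmallJumps

/-! ### Choice of constants and conclusion. -/

theorem mainTheorem8 (β cplus cminus cmax : ℝ) (hβ0 : 0 < β) (hβ2 : β < 2)
    (hcminus : 0 < cminus) (hcplus : cminus < cplus) (hcmax : 0 ≤ cmax) :
    ∃ c₀ : ℝ, 0 < c₀ ∧ ∀ c : ℝ, c₀ ≤ c → ∃ ctilde : ℝ, 0 < ctilde ∧ ctilde < 1 ∧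
      ∀ (b sig ε : ℝ) (Δ : ℝ≥0) (n : ℕ) (ν : Measure ℝ),
        0 ≤ sig → 0 < Δ → 0 < ε → 1 ≤ n →
        SmallJumps.IsLevyMeasure ν → ν ≪ volume →
        (∀ᵐ x : ℝ, x ∈ Icc (-ε) ε → x ≠ 0 →
          ENNReal.ofReal (cminus / |x| ^ (β + 1)) ≤ ν.rnDeriv volume x ∧
          ν.rnDeriv volume x ≤ ENNReal.ofReal (cplus / |x| ^ (β + 1))) →
        1 ≤ (n : ℝ) ^ cmax * Δ →
        Real.log (sig ^ 2 + SmallJumps.sigmaSq ν ε) / SmallJumps.logMax n ≤ cmax →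
        ε ≤ ctilde * Real.sqrt (Δ * (sig ^ 2 + SmallJumps.sigmaSq ν ε)) /
          Real.sqrt (SmallJumps.logMax n) →
        ∀ {Ω : Type*} [MeasurableSpace Ω] (P : Measure Ω) [IsProbabilityMeasure P]
          (X : ℝ≥0 → Ω → ℝ),
          SmallJumps.HasLevyTriplet X P b sig (SmallJumps.smallJumpMeasure ν ε) →
          ContDiff ℝ (⊤ : ℕ∞) (SmallJumps.Psi P X b sig (SmallJumps.smallJumpMeasure ν ε) ε Δ) ∧
          ∀ k : ℕ, (k : ℝ) ≤ 401 * SmallJumps.logMax n →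
            IntegrableOn (fun t : ℝ => ‖iteratedDeriv k
              (SmallJumps.Psi P X b sig (SmallJumps.smallJumpMeasure ν ε) ε Δ) t‖ ^ 2)
              (Ici (c * SmallJumps.logMax n)) ∧
            ∫ t in Ici (c * SmallJumps.logMax n), ‖iteratedDeriv k
              (SmallJumps.Psi P X b sig (SmallJumps.smallJumpMeasure ν ε) ε Δ) t‖ ^ 2
              ≤ 3 * (k.factorial : ℝ) * (n : ℝ) ^ (-4 : ℤ) := by
  set q : ℝ := cminus / cplus
  have hcp0 : 0 < cplus := hcminus.trans hcplus
  have hq0 : 0 < q := div_pos hcminus hcp0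
  have hq1 : q ≤ 1 := div_le_one_of_le₀ hcplus.le hcp0.le
  set κ : ℝ := Real.exp (-1) * (q / 5)
  have hκ : 0 < κ := by positivity
  obtain ⟨l, hl0, hl⟩ := SmallJumps.exists_exp_neg_rpow_le hκ hβ0
  -- 806 = 2 · 401 + 4: the squared cost of the circle plus the exponent of n⁻⁴. The term l pays for
  -- trading the t^β decay for t⁻².
  refine ⟨42 + 4 * (806 + l) / κ, by positivity, fun c hc => ?_⟩
  have hκl : 0 ≤ 4 * (806 + l) / κ := by positivity
  have hc42 : 42 ≤ c := by linarith
  have hc0 : 0 < c := by linarith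
  have hκc : 806 + l ≤ κ * c ^ 2 / 4 := by
    have h1 : 4 * (806 + l) / κ ≤ c := by linarith
    rw [div_le_iff₀ hκ] at h1
    nlinarith [mul_le_mul_of_nonneg_left hc42 (by positivity : 0 ≤ κ * c)]
  refine ⟨1 / c, by positivity, by rw [div_lt_one hc0]; linarith, ?_⟩
  intro b sig ε Δ n ν _ _ hε hn hν hac hdens _ _ hεle Ω _ P _ X hX
  set L := SmallJumps.logMax n
  have hL : 1 ≤ L := SmallJumps.one_le_logMax n
  set μ := SmallJumps.smallJumpMeasure ν ε with hμdef
  set s := Real.sqrt (Δ * (sig ^ 2 + SmallJumps.sigmaSq ν ε)) with hsdef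
  have hsqL : 0 < Real.sqrt L := Real.sqrt_pos.2 (by linarith)
  -- If s were 0, the smallness condition would read ε ≤ 0.
  have hs : 0 < s := by
    by_contra h
    have : s = 0 := le_antisymm (not_lt.1 h) (Real.sqrt_nonneg _)
    rw [this] at hεle
    simp at hεle
    linarith
  have hs2 : s ^ 2 = Δ * (sig ^ 2 + SmallJumps.sigmaSq ν ε) :=
    Real.sq_sqrt (Real.sqrt_pos.1 hs).le
  have hεs : (ε / s) ^ 2 * (c ^ 2 * L) ≤ 1 := by
    have h1 : ε / s * (c * Real.sqrt L) ≤ 1 := by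
      rw [le_div_iff₀ hsqL] at hεle
      calc ε / s * (c * Real.sqrt L) = ε * Real.sqrt L * (c / s) := by ring
        _ ≤ 1 / c * s * (c / s) := by gcongr
        _ = 1 := by field_simp
    calc (ε / s) ^ 2 * (c ^ 2 * L) = (ε / s * (c * Real.sqrt L)) ^ 2 := by
          rw [mul_pow, mul_pow, Real.sq_sqrt (by linarith)]
      _ ≤ 1 := pow_le_one₀ (by positivity) h1
  have hμ := SmallJumps.ae_abs_le_smallJumpMeasure ν ε
  have hint := hν.integrable_sq ε
  have hdiff : Differentiable ℂ fun z => Complex.exp (SmallJumps.scaledExponent sig Δ s μ z) :=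
    (SmallJumps.differentiable_scaledExponent sig Δ s hμ hint).cexp
  have hPsi : SmallJumps.Psi P X b sig μ ε Δ =
      fun t : ℝ => Complex.exp (SmallJumps.scaledExponent sig Δ s μ t) := by
    ext t
    have h0 : SmallJumps.noJumpProb μ ε Δ = 0 :=
      SmallJumps.noJumpProb_eq_zero hν hac hβ0 hε hcminus
        (hdens.mono fun x hx h1 h2 => (hx h1 h2).1) Δ
    have hσ : SmallJumps.sigmaSq μ ε = SmallJumps.sigmaSq ν ε := by
      rw [SmallJumps.sigmaSq, hμdef, SmallJumps.smallJumpMeasure_smallJumpMeasure ν le_rfl,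
        SmallJumps.sigmaSq]
    rw [SmallJumps.Psi, h0, SmallJumps.integral_exp_rescaledIncrement hX hμ hint, hσ]
    simp [← hsdef]
  rw [hPsi]
  refine ⟨SmallJumps.contDiff_comp_ofReal hdiff, fun k hk => ?_⟩
  have hcont : Continuous fun t : ℝ => ‖iteratedDeriv k
      (fun t : ℝ => Complex.exp (SmallJumps.scaledExponent sig Δ s μ t)) t‖ ^ 2 :=
    (((SmallJumps.contDiff_comp_ofReal hdiff (n := k)).continuous_iteratedDeriv k
      le_rfl).norm).pow 2
  have hT : 1 ≤ c * L := by nlinarith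
  have hbound := SmallJumps.integrableOn_and_integral_le_of_le_rpow_neg_two hcont
    (A := k.factorial * Real.exp (-(4 * L))) (by positivity) hT (fun t => sq_nonneg _) ?_
  · refine ⟨hbound.1, hbound.2.trans ?_⟩
    have h1 := SmallJumps.exp_neg_four_mul_logMax_le hn
    calc (k.factorial : ℝ) * Real.exp (-(4 * L)) ≤ k.factorial * (n : ℝ) ^ (-4 : ℤ) := by gcongr
      _ ≤ 3 * (k.factorial * (n : ℝ) ^ (-4 : ℤ)) :=
          le_mul_of_one_le_left (by positivity) (by norm_num)
      _ = _ := by ring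
  · intro t ht
    have ht2 : 2 ≤ t := by nlinarith
    rw [SmallJumps.iteratedDeriv_comp_ofReal hdiff k]
    refine (SmallJumps.sq_norm_iteratedDeriv_le hdiff
      (Real.sqrt_pos.2 (by positivity : 0 < 401 * L))
      (hk.trans_eq (Real.sq_sqrt (by positivity)).symm) fun z hz =>
        SmallJumps.norm_exp_scaledExponent_le_on_sphere hν hβ0 hβ2 hε hq0 hq1 Δ.2
          (fun δ h1 h2 => SmallJumps.sigmaSq_lower_bound hν hac hε hcminus hcplus hdens h1 h2)
          hs hs2 hc42 hL hεs ht hz).trans ?_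
    rw [mul_assoc (k.factorial : ℝ)]
    refine mul_le_mul_of_nonneg_left ?_ (by positivity)
    rw [← Real.exp_nat_mul]
    calc Real.exp ((2 : ℕ) * (401 * L - κ * ((c ^ 2 * L / 4 + (t / 2) ^ β) / 2)))
        = Real.exp (802 * L - κ * c ^ 2 / 4 * L) * Real.exp (-(κ * (t / 2) ^ β)) := by
          rw [← Real.exp_add]
          congr 1
          push_cast
          ring
      _ ≤ Real.exp (802 * L - κ * c ^ 2 / 4 * L) * (Real.exp l * t ^ (-2 : ℝ)) := by
          gcongr
          exact hl t ht2
      _ = Real.exp (802 * L - κ * c ^ 2 / 4 * L + l) * t ^ (-2 : ℝ) := by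
          rw [Real.exp_add]; ring
      _ ≤ _ := by
          gcongr
          nlinarith [mul_le_mul_of_nonneg_right hκc (by linarith : 0 ≤ L)]
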